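/- Let $\Theta\in\mathbb R^{n\times n}$ and $J\in\mathbb R^{m\times m}$ be real antisymmetric matrices and put $\Omega:=I_m+iJ$. Let $X=(X_1,\dots,X_n)^{\mathsf T}$ be a vector of (unbounded) self-adjoint operators on a complex Hilbert space $\mathfrak H$ such that for every $u\in\mathbb R^n$ the closure of $\sum_k u_kX_k$, denoted $u^{\mathsf T}X$, is self-adjoint, and such that the Weyl operators $\mathcal W_u:=e^{iu^{\mathsf T}X}$ satisfy the canonical commutation relations $$\mathcal W_{u+v}=e^{iu^{\mathsf T}\Theta v}\,\mathcal W_u\mathcal W_v=e^{-iu^{\mathsf T}\Theta v}\,\mathcal W_v\mathcal W_u,\qquad u,v\in\mathbb R^n .$$ Let $H_0,H_1,\dots,H_m:\mathbb R^n\to\mathbb C$ be Hermitian functions, i.e. $H_k(-u)=\overline{H_k(u)}$ for all $u$, with $\int_{\mathbb R^n}(1+|u|)\,|H_k(u)|\,du<\infty$. Let $$h_k:=\int_{\mathbb R^n}H_k(u)\,\mathcal W_u\,du,\qquad k=0,1,\dots,m,$$ (strong Bochner integrals: $h_k\psi=\int H_k(u)\mathcal W_u\psi\,du$ for every $\psi\in\mathfrak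 H$), let $h=(h_1,\dots,h_m)^{\mathsf T}$ and $H=(H_1,\dots,H_m)^{\mathsf T}$. Define the drift vector $f$ and the dispersion $(n\times m)$-matrix $g$ by $$f:=i[h_0,X]+\mathcal D(X),\qquad g:=-i[X,h^{\mathsf T}],\qquad \mathcal D(\xi):=\tfrac12\sum_{j,k=1}^m\omega_{jk}\big([h_j,\xi]h_k+h_j[\xi,h_k]\big),\quad \Omega=(\omega_{jk}),$$ where $\mathcal D$ and the commutators with $X$ act entrywise and products and sums of unbounded operators are taken on their natural domains. Put $$K(u,v):=\operatorname{Im}\big(e^{iu^{\mathsf T}\Theta v}\Omega\big),\qquad G(u):=2i\,\Theta u\,H(u)^{\mathsf T},$$ $$F(u):=2i\,\Theta\Big(H_0(u)\,u+\int_{\mathbb R^n}v\,H(v)^{\mathsf T}K(u,v)H(u-v)\,dv\Big),$$ where $\operatorname{Im}$ is taken entrywise, and where the integral in $F(u)$ is set to be $0$ for those $u$ for which it does not converge absolutely. Then: 1. $K(u,v)=\sin(u^{\mathsf T}\Theta v)\,I_m+\cos(u^{\mathsf T}\Theta v)\,J$ for all $u,v$. 2. The integral in $F(u)$ converges absolutely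 for almost every $u$; the functions $F:\mathbb R^n\to\mathbb C^n$ and $G:\mathbb R^n\to\mathbb C^{n\times m}$ are Hermitian ($F(-u)=\overline{F(u)}$, $G(-u)=\overline{G(u)}$ for all $u$) and absolutely integrable. Consequently the operators $h_k$, $\int F_k(u)\mathcal W_u\,du$ and $\int G_{kj}(u)\mathcal W_u\,du$ are defined on all of $\mathfrak H$. 3. $f$ and $g$ are the Weyl quantizations $$f=\int_{\mathbb R^n}F(u)\,\mathcal W_u\,du,\qquad g=\int_{\mathbb R^n}G(u)\,\mathcal W_u\,du$$ in the following sense: for all $k,j$, the natural domain of each of $f_k$ and $g_{kj}$ is exactly the domain of $X_k$, the equality holds on this domain, and the closures of $f_k$ and $g_{kj}$ are equal to $\int F_k(u)\mathcal W_u\,du$ and $\int G_{kj}(u)\mathcal W_u\,du$, respectively. -/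

import Mathlib

open MeasureTheory Matrix

noncomputable section

section Operators

variable {𝓗 : Type*} [NormedAddCommGroup 𝓗] [InnerProductSpace ℂ 𝓗]

/-- Product `A B` of two unbounded operators on its natural domain
`{ψ ∈ dom B | B ψ ∈ dom A}`. -/
def opMul (A B : 𝓗 →ₗ.[ℂ] 𝓗) : 𝓗 →ₗ.[ℂ] 𝓗 where
  domain := (A.domain.comap B.toFun).map B.domain.subtype
  toFun :=
    { toFun := fun ψ =>
        A ⟨B ⟨ψ.1, by obtain ⟨_, ⟨χ, _, rfl⟩⟩ := ψ; exact χ.2⟩, by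
          obtain ⟨_, ⟨χ, hχ, rfl⟩⟩ := ψ; exact hχ⟩
      map_add' := fun ψ φ => by
        rw [← LinearPMap.map_add]
        congr 1
        apply Subtype.ext
        change _ = B _ + B _
        rw [← LinearPMap.map_add]
        rfl
      map_smul' := fun c ψ => by
        rw [RingHom.id_apply, ← LinearPMap.map_smul]
        congr 1
        apply Subtype.ext
        change _ = c • B _
        rw [← LinearPMap.map_smul]
        rfl }

/-- Commutator `[A, B] = A B - B A`, on the natural domain. -/
def opComm (A B : 𝓗 →ₗ.[ℂ] 𝓗) : 𝓗 →ₗ.[ℂ] 𝓗 := opMul A B - opMul B A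

/-- `A` is self-adjoint and `U t = exp (i t A)`: `U` is the strongly continuous one-parameter
unitary group whose infinitesimal generator (on its full domain) is `i A`. -/
structure IsUnitaryExp [CompleteSpace 𝓗] (A : 𝓗 →ₗ.[ℂ] 𝓗) (U : ℝ → 𝓗 →L[ℂ] 𝓗) : Prop where
  selfAdjoint : IsSelfAdjoint A
  unitary : ∀ t, U t ∈ unitary (𝓗 →L[ℂ] 𝓗)
  map_zero : U 0 = 1
  map_add : ∀ s t, U (s + t) = U s * U t
  continuous : ∀ ψ, Continuous fun t => U t ψ
  mem_domain_iff : ∀ ψ, ψ ∈ A.domain ↔ DifferentiableAt ℝ (fun t => U t ψ) 0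
  hasDerivAt : ∀ ψ : A.domain, HasDerivAt (fun t => U t (ψ : 𝓗)) (Complex.I • A ψ) 0

variable {ι : Type*} [Fintype ι]

/-- The operator `uᵀ X`: the closure of `∑ k, u k • X k`, which is defined on `⋂ k, dom (X k)`. -/
def linComb (X : ι → 𝓗 →ₗ.[ℂ] 𝓗) (u : ι → ℝ) : 𝓗 →ₗ.[ℂ] 𝓗 :=
  (∑ k, (u k : ℂ) • X k).closure

/-- The self-adjoint system variables `X k` satisfy the Weyl canonical commutation relations with
CCR matrix `Θ`, and `W u = exp (i uᵀ X)` are their Weyl operators. -/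
structure IsWeylSystem [CompleteSpace 𝓗] (Θ : Matrix ι ι ℝ) (X : ι → 𝓗 →ₗ.[ℂ] 𝓗)
    (W : (ι → ℝ) → 𝓗 →L[ℂ] 𝓗) : Prop where
  selfAdjoint : ∀ k, IsSelfAdjoint (X k)
  exp : ∀ u, IsUnitaryExp (linComb X u) fun t => W (t • u)
  ccr : ∀ u v, W (u + v) =
    Complex.exp (Complex.I * ((u ⬝ᵥ Θ *ᵥ v : ℝ) : ℂ)) • (W u * W v)
  ccr' : ∀ u v, W (u + v) =
    Complex.exp (-(Complex.I * ((u ⬝ᵥ Θ *ᵥ v : ℝ) : ℂ))) • (W v * W u)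

/-- The vectors `ψ` for which `u ↦ H(u) W_u ψ` is Bochner integrable. -/
def weylDomain (W : (ι → ℝ) → 𝓗 →L[ℂ] 𝓗) (H : (ι → ℝ) → ℂ) : Submodule ℂ 𝓗 where
  carrier := {ψ | Integrable (fun u => H u • W u ψ) volume}
  zero_mem' := by simp
  add_mem' := fun {ψ φ} hψ hφ => by
    refine (Integrable.add (Set.mem_ofPred.mp hψ) (Set.mem_ofPred.mp hφ)).congr
      (Filter.Eventually.of_forall fun u => ?_)
    simp
  smul_mem' := fun c ψ hψ => by
    refine (Integrable.smul c (Set.mem_ofPred.mp hψ)).congr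
      (Filter.Eventually.of_forall fun u => ?_)
    simp [smul_comm c]

/-- The Weyl quantization `∫ H(u) W_u du`, understood strongly: it sends `ψ` to the Bochner
integral `∫ H(u) W_u ψ du`, whenever this exists. -/
def weylQuant (W : (ι → ℝ) → 𝓗 →L[ℂ] 𝓗) (H : (ι → ℝ) → ℂ) : 𝓗 →ₗ.[ℂ] 𝓗 where
  domain := weylDomain W H
  toFun :=
    { toFun := fun ψ => ∫ u, H u • W u (ψ : 𝓗)
      map_add' := fun ψ φ => by
        rw [← integral_add (Set.mem_ofPred.mp ψ.2) (Set.mem_ofPred.mp φ.2)]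
        simp
      map_smul' := fun c ψ => by
        rw [RingHom.id_apply, ← integral_smul]
        simp [smul_comm c] }

variable {κ : Type*} [Fintype κ]

/-- The decoherence superoperator
`D(ξ) = 1/2 ∑ j k, ω_{jk} ([h_j, ξ] h_k + h_j [ξ, h_k])`. -/
def decoherence (Ω : Matrix κ κ ℂ) (h : κ → 𝓗 →ₗ.[ℂ] 𝓗) (ξ : 𝓗 →ₗ.[ℂ] 𝓗) : 𝓗 →ₗ.[ℂ] 𝓗 :=
  (1 / 2 : ℂ) • ∑ j, ∑ k,
    Ω j k • (opMul (opComm (h j) ξ) (h k) + opMul (h j) (opComm ξ (h k)))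

/-- The drift vector `f = i[h_0, X] + D(X)`, entrywise. -/
def drift (Ω : Matrix κ κ ℂ) (h₀ : 𝓗 →ₗ.[ℂ] 𝓗) (h : κ → 𝓗 →ₗ.[ℂ] 𝓗)
    (X : ι → 𝓗 →ₗ.[ℂ] 𝓗) (k : ι) : 𝓗 →ₗ.[ℂ] 𝓗 :=
  Complex.I • opComm h₀ (X k) + decoherence Ω h (X k)

/-- The dispersion matrix `g = -i[X, hᵀ]`, entrywise. -/
def dispersion (h : κ → 𝓗 →ₗ.[ℂ] 𝓗) (X : ι → 𝓗 →ₗ.[ℂ] 𝓗) (k : ι) (j : κ) : 𝓗 →ₗ.[ℂ] 𝓗 :=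
  (-Complex.I) • opComm (X k) (h j)

end Operators

section Symbols

variable {ι κ : Type*} [Fintype ι] [Fintype κ]

/-- The quantum Ito matrix `Ω = I + i J`. -/
def itoMatrix [DecidableEq κ] (J : Matrix κ κ ℝ) : Matrix κ κ ℂ :=
  1 + Complex.I • J.map Complex.ofReal

/-- `K(u,v) = Im (exp (i uᵀ Θ v) Ω)`, entrywise. -/
def symbolK (Θ : Matrix ι ι ℝ) (Ω : Matrix κ κ ℂ) (u v : ι → ℝ) : Matrix κ κ ℝ :=
  (Complex.exp (Complex.I * ((u ⬝ᵥ Θ *ᵥ v : ℝ) : ℂ)) • Ω).map Complex.im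

/-- The vector `v H(v)ᵀ K(u,v) H(u-v)`. -/
def driftIntegrand (Θ : Matrix ι ι ℝ) (Ω : Matrix κ κ ℂ) (H : (ι → ℝ) → κ → ℂ)
    (u v : ι → ℝ) : ι → ℂ :=
  (H v ⬝ᵥ (symbolK Θ Ω u v).map Complex.ofReal *ᵥ H (u - v)) • fun l => (v l : ℂ)

/-- `F(u) = 2 i Θ (H₀(u) u + ∫ v H(v)ᵀ K(u,v) H(u-v) dv)`. -/
def symbolF (Θ : Matrix ι ι ℝ) (Ω : Matrix κ κ ℂ) (H₀ : (ι → ℝ) → ℂ) (H : (ι → ℝ) → κ → ℂ)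
    (u : ι → ℝ) : ι → ℂ :=
  ((2 * Complex.I) • Θ.map Complex.ofReal) *ᵥ
    ((H₀ u • fun l => (u l : ℂ)) + ∫ v, driftIntegrand Θ Ω H u v)

/-- `G(u) = 2 i Θ u H(u)ᵀ`. -/
def symbolG (Θ : Matrix ι ι ℝ) (H : (ι → ℝ) → κ → ℂ) (u : ι → ℝ) : Matrix ι κ ℂ :=
  ((2 * Complex.I) • Θ.map Complex.ofReal) * vecMulVec (fun l => (u l : ℂ)) (H u)

end Symbols

end

/-! Differentiating the relation `W (t e_k) * W u = exp (-2 i t (Θ u)_k) • (W u * W (t e_k))` at `t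
= 0` gives `X_k W_u = W_u X_k - 2 (Θ u)_k W_u` on `dom X_k` (`exists_apply_weyl`). Integrating this
against a symbol `P` shows that the bounded operator `T = ∫ P(u) W_u du` preserves `dom X_k` and
that `[T, X_k]` is there the bounded operator `D` with symbol `2 (Θ u)_k P(u)`
(`exists_apply_quantCLM`); this is where the first moment of the symbol is needed. Multiplying by
`i` gives `g`.

For the drift, `f_k` becomes `i D₀ + 1/2 ∑ ω_{jl} (D_j h_l - h_j D_l)` on `dom X_k`. A product of
quantizations is the quantization of a twisted convolution (`quantCLM_quantCLM`). Substituting `v ↦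
u - v` in the terms `h_j D_l` conjugates the phase, and exchanging `j` and `l` then combines both
kinds of terms into `z - conj z = 2 i Im z`, because `Ω` is Hermitian. This produces the kernel `K`
and hence `F` (`symbolF_ae_eq`).

Natural domains equal `dom X_k` because all the other factors are everywhere defined and preserve
it; closures follow from boundedness and density of `dom X_k`. -/

namespace LinearPMap

/-! ### Order, closure and self-adjointness of partially defined operators -/

section Algebra

variable {R E F : Type*} [CommRing R] [AddCommGroup E] [Module R E] [AddCommGroup F] [Module R F]

theorem le_iff_exists {f g : E →ₗ.[R] F} :
    f ≤ g ↔ ∀ x : f.domain, ∃ hx : (x : E) ∈ g.domain, g ⟨x, hx⟩ = f x := by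
  constructor
  · exact fun h x => ⟨h.1 x.2, (h.2 (y := ⟨x, h.1 x.2⟩) rfl).symm⟩
  · refine fun h => ⟨fun x hx => (h ⟨x, hx⟩).1, fun x y hxy => ?_⟩
    obtain ⟨hx, e⟩ := h x
    rw [← e]
    congr 1
    exact Subtype.ext hxy

theorem toPMap_le_iff {f : E →ₗ[R] F} {S : Submodule R E} {g : E →ₗ.[R] F} :
    f.toPMap S ≤ g ↔ ∀ x ∈ S, ∃ hx : x ∈ g.domain, g ⟨x, hx⟩ = f x :=
  le_iff_exists.trans ⟨fun h x hx => h ⟨x, hx⟩, fun h x => h x x.2⟩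

protected theorem add_le_add {f f' g g' : E →ₗ.[R] F} (h : f ≤ f') (h' : g ≤ g') :
    f + g ≤ f' + g' := by
  refine ⟨inf_le_inf h.1 h'.1, fun x y hxy => ?_⟩
  rw [add_apply, add_apply]
  congr 1
  · exact h.2 hxy
  · exact h'.2 hxy

protected theorem smul_le_smul (c : R) {f g : E →ₗ.[R] F} (h : f ≤ g) : c • f ≤ c • g := by
  refine ⟨h.1, fun x y hxy => ?_⟩
  rw [smul_apply, smul_apply]
  congr 1
  exact h.2 hxy

protected theorem sum_le_sum {α : Type*} (s : Finset α) {f g : α → E →ₗ.[R] F}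
    (h : ∀ a ∈ s, f a ≤ g a) : ∑ a ∈ s, f a ≤ ∑ a ∈ s, g a := by
  classical
  induction s using Finset.induction_on with
  | empty => simp
  | insert a s ha ih =>
    rw [Finset.sum_insert ha, Finset.sum_insert ha]
    exact LinearPMap.add_le_add (h a (by simp)) (ih fun b hb => h b (by simp [hb]))

theorem zero_smul_le (f : E →ₗ.[R] F) : (0 : R) • f ≤ 0 :=
  ⟨le_top, fun x y _ => by rw [smul_apply, zero_smul]; rfl⟩

theorem toPMap_smul (c : R) (f : E →ₗ[R] F) (S : Submodule R E) :
    c • f.toPMap S = (c • f).toPMap S := rfl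

theorem toPMap_add_le (f g : E →ₗ[R] F) (S : Submodule R E) :
    (f + g).toPMap S ≤ f.toPMap S + g.toPMap S :=
  toPMap_le_iff.2 fun _ hx => ⟨⟨hx, hx⟩, rfl⟩

theorem toPMap_sum_le {α : Type*} (s : Finset α) (f : α → E →ₗ[R] F) (S : Submodule R E) :
    (∑ a ∈ s, f a).toPMap S ≤ ∑ a ∈ s, (f a).toPMap S := by
  classical
  induction s using Finset.induction_on with
  | empty =>
    rw [Finset.sum_empty, Finset.sum_empty]
    exact toPMap_le_iff.2 fun x hx => ⟨trivial, rfl⟩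
  | insert a s ha ih =>
    rw [Finset.sum_insert ha, Finset.sum_insert ha]
    exact (toPMap_add_le _ _ S).trans (LinearPMap.add_le_add le_rfl ih)

/-- The domain of `B` may exceed `S`, but the sum lives on the intersection. So a lower bound on the
decoherence term suffices to identify the drift exactly. -/
theorem toPMap_add_eq_of_le {f g : E →ₗ[R] F} {S : Submodule R E} {B : E →ₗ.[R] F}
    (h : g.toPMap S ≤ B) : f.toPMap S + B = (f + g).toPMap S := by
  refine (eq_of_le_of_domain_eq ((toPMap_add_le f g S).trans
    (LinearPMap.add_le_add le_rfl h)) ?_).symm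
  exact (inf_eq_left.2 h.1).symm

theorem domRestrict_toPMap_top (f : E →ₗ[R] F) (S : Submodule R E) :
    (f.toPMap ⊤).domRestrict S = f.toPMap S := by
  refine (eq_of_le_of_domain_eq (toPMap_le_iff.2 fun x hx =>
    ⟨show x ∈ S ⊓ ⊤ from ⟨hx, trivial⟩, rfl⟩) ?_).symm
  exact (inf_top_eq S).symm

end Algebra

section Topology

variable {𝕜 E F : Type*} [RCLike 𝕜] [NormedAddCommGroup E] [NormedSpace 𝕜 E]
  [NormedAddCommGroup F] [NormedSpace 𝕜 F]

theorem toPMap_top_isClosed (T : E →L[𝕜] F) : ((T : E →ₗ[𝕜] F).toPMap ⊤).IsClosed := by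
  have : (((T : E →ₗ[𝕜] F).toPMap ⊤).graph : Set (E × F)) = {p | T p.1 = p.2} := by
    ext p
    simp
  rw [IsClosed, this]
  exact isClosed_eq (by fun_prop) (by fun_prop)

theorem closure_toPMap_of_dense (T : E →L[𝕜] F) {S : Submodule 𝕜 E} (hS : Dense (S : Set E)) :
    ((T : E →ₗ[𝕜] F).toPMap S).closure = (T : E →ₗ[𝕜] F).toPMap ⊤ := by
  have hle : (T : E →ₗ[𝕜] F).toPMap S ≤ (T : E →ₗ[𝕜] F).toPMap ⊤ :=
    toPMap_le_iff.2 fun x _ => ⟨trivial, rfl⟩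
  have hc := (toPMap_top_isClosed T).isClosable.leIsClosable hle
  apply eq_of_eq_graph
  rw [← hc.graph_closure_eq_closure_graph]
  apply le_antisymm
  · exact Submodule.topologicalClosure_minimal _ (le_graph_of_le hle) (toPMap_top_isClosed T)
  · rintro ⟨x, y⟩ hxy
    obtain rfl : T x = y := by simpa using hxy
    have hcont : Continuous fun z : E => (z, T z) := by fun_prop
    have h1 := hcont.continuousAt (x := x) |>.continuousWithinAt (s := (S : Set E))
    refine (ContinuousWithinAt.mem_closure h1 (hS x) (t := _) ?_ :)
    intro z hz
    exact (mem_graph_iff _).2 ⟨⟨z, hz⟩, rfl, rfl⟩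

end Topology

section Adjoint

variable {𝕜 E : Type*} [RCLike 𝕜] [NormedAddCommGroup E] [InnerProductSpace 𝕜 E] [CompleteSpace E]

theorem inner_apply_of_isSelfAdjoint {A : E →ₗ.[𝕜] E} (hA : IsSelfAdjoint A) (x y : A.domain) :
    inner 𝕜 (A x) (y : E) = inner 𝕜 (x : E) (A y) := by
  have h := adjoint_isFormalAdjoint hA.dense_domain
  rw [isSelfAdjoint_def.1 hA] at h
  exact h x y

theorem exists_apply_eq_of_isSelfAdjoint {A : E →ₗ.[𝕜] E} (hA : IsSelfAdjoint A) {x y : E}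
    (h : ∀ z : A.domain, inner 𝕜 y (z : E) = inner 𝕜 x (A z)) :
    ∃ hx : x ∈ A.domain, A ⟨x, hx⟩ = y := by
  have hx : x ∈ (A.adjoint).domain := mem_adjoint_domain_of_exists x ⟨y, h⟩
  have hy : A.adjoint ⟨x, hx⟩ = y := adjoint_apply_eq hA.dense_domain ⟨x, hx⟩ h
  -- The membership proof depends on the operator, so `A.adjoint = A` is transported through a
  -- generalized `B`.
  have key : ∀ B : E →ₗ.[𝕜] E, B = A → (∃ hx : x ∈ B.domain, B ⟨x, hx⟩ = y) →
      ∃ hx : x ∈ A.domain, A ⟨x, hx⟩ = y := by rintro _ rfl h; exact h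
  exact key _ (isSelfAdjoint_def.1 hA) ⟨hx, hy⟩

theorem eq_of_le_of_isSelfAdjoint {A B : E →ₗ.[𝕜] E} (hA : IsSelfAdjoint A)
    (hB : IsSelfAdjoint B) (h : A ≤ B) : A = B := by
  refine le_antisymm h (le_iff_exists.2 fun x => ?_)
  refine exists_apply_eq_of_isSelfAdjoint hA fun z => ?_
  obtain ⟨hz, e⟩ := le_iff_exists.1 h z
  rw [← e]
  exact inner_apply_of_isSelfAdjoint hB x ⟨z, hz⟩

end Adjoint

end LinearPMap

/-! ### Commutators and products on natural domains -/

section OperatorProducts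

open LinearPMap

variable {𝓗 : Type*} [NormedAddCommGroup 𝓗] [InnerProductSpace ℂ 𝓗]

theorem mem_opMul_domain {A B : 𝓗 →ₗ.[ℂ] 𝓗} {x : 𝓗} :
    x ∈ (opMul A B).domain ↔ ∃ hx : x ∈ B.domain, B ⟨x, hx⟩ ∈ A.domain := by
  constructor
  · rintro ⟨χ, hχ, rfl⟩
    exact ⟨χ.2, hχ⟩
  · rintro ⟨hx, hy⟩
    exact ⟨⟨x, hx⟩, hy, rfl⟩

theorem le_opMul_iff {A B C : 𝓗 →ₗ.[ℂ] 𝓗} :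
    C ≤ opMul A B ↔ ∀ x : C.domain, ∃ (hx : (x : 𝓗) ∈ B.domain)
      (hy : B ⟨x, hx⟩ ∈ A.domain), A ⟨B ⟨x, hx⟩, hy⟩ = C x := by
  rw [le_iff_exists]
  refine forall_congr' fun x => ⟨?_, ?_⟩
  · rintro ⟨hx, h⟩
    obtain ⟨hx, hy⟩ := mem_opMul_domain.1 hx
    exact ⟨hx, hy, h⟩
  · rintro ⟨hx, hy, h⟩
    exact ⟨mem_opMul_domain.2 ⟨hx, hy⟩, h⟩

variable {A : 𝓗 →ₗ.[ℂ] 𝓗} {S : Submodule ℂ 𝓗}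

/-- As `T` is everywhere defined, `T A` already has domain `dom A`; the hypothesis puts `dom A`
inside the domain of `A T`, so nothing is lost in the difference. -/
theorem opComm_toPMap_left {T D : 𝓗 →ₗ[ℂ] 𝓗}
    (h : ∀ x : A.domain, ∃ hx : T x ∈ A.domain, A ⟨T x, hx⟩ = T (A x) - D x) :
    opComm (T.toPMap ⊤) A = D.toPMap A.domain := by
  refine (eq_of_le_of_domain_eq (toPMap_le_iff.2 fun x hx => ?_) ?_).symm
  · obtain ⟨hy, e⟩ := h ⟨x, hx⟩
    have h1 : x ∈ (opMul (T.toPMap ⊤) A).domain := mem_opMul_domain.2 ⟨hx, trivial⟩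
    have h2 : x ∈ (opMul A (T.toPMap ⊤)).domain := mem_opMul_domain.2 ⟨trivial, hy⟩
    refine ⟨⟨h1, h2⟩, ?_⟩
    change T (A ⟨x, hx⟩) - A ⟨T x, hy⟩ = D x
    rw [e, sub_sub_cancel]
  · refine le_antisymm (fun x hx => ⟨mem_opMul_domain.2 ⟨hx, trivial⟩,
      mem_opMul_domain.2 ⟨trivial, (h ⟨x, hx⟩).1⟩⟩) fun x hx => ?_
    exact (mem_opMul_domain.1 hx.1).1

theorem opComm_toPMap_right {T D : 𝓗 →ₗ[ℂ] 𝓗}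
    (h : ∀ x : A.domain, ∃ hx : T x ∈ A.domain, A ⟨T x, hx⟩ = T (A x) - D x) :
    opComm A (T.toPMap ⊤) = (-D).toPMap A.domain := by
  have e : opComm A (T.toPMap ⊤) = -opComm (T.toPMap ⊤) A := (neg_sub _ _).symm
  rw [e, opComm_toPMap_left h]
  rfl

theorem toPMap_comp_le_opMul_toPMap_top {T D : 𝓗 →ₗ[ℂ] 𝓗} (h : ∀ x ∈ S, T x ∈ S) :
    (D ∘ₗ T).toPMap S ≤ opMul (D.toPMap S) (T.toPMap ⊤) :=
  le_opMul_iff.2 fun x => ⟨trivial, h x x.2, rfl⟩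

theorem toPMap_comp_le_toPMap_top_opMul (T D : 𝓗 →ₗ[ℂ] 𝓗) :
    (T ∘ₗ D).toPMap S ≤ opMul (T.toPMap ⊤) (D.toPMap S) :=
  le_opMul_iff.2 fun x => ⟨x.2, trivial, rfl⟩

theorem dispersion_toPMap_top {ι κ : Type*} {T D : κ → 𝓗 →ₗ[ℂ] 𝓗} (X : ι → 𝓗 →ₗ.[ℂ] 𝓗) (i : ι)
    (j : κ) (h : ∀ x : (X i).domain, ∃ hx : T j x ∈ (X i).domain,
      X i ⟨T j x, hx⟩ = T j (X i x) - D j x) :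
    dispersion (fun j => (T j).toPMap ⊤) X i j = (Complex.I • D j).toPMap (X i).domain := by
  rw [dispersion, opComm_toPMap_right h, toPMap_smul, smul_neg, neg_smul, neg_neg]

variable {κ : Type*} [Fintype κ]

theorem toPMap_le_decoherence (Ω : Matrix κ κ ℂ) {T D : κ → 𝓗 →ₗ[ℂ] 𝓗}
    (h : ∀ j, ∀ x : A.domain, ∃ hx : T j x ∈ A.domain, A ⟨T j x, hx⟩ = T j (A x) - D j x) :
    ((1 / 2 : ℂ) • ∑ j, ∑ k, Ω j k • (D j ∘ₗ T k - T j ∘ₗ D k)).toPMap A.domain ≤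
      decoherence Ω (fun j => (T j).toPMap ⊤) A := by
  rw [decoherence, ← toPMap_smul]
  refine LinearPMap.smul_le_smul _ ((toPMap_sum_le _ _ _).trans ?_)
  refine LinearPMap.sum_le_sum _ fun j _ => (toPMap_sum_le _ _ _).trans ?_
  refine LinearPMap.sum_le_sum _ fun k _ => ?_
  rw [← toPMap_smul, opComm_toPMap_left (h j), opComm_toPMap_right (h k), sub_eq_add_neg]
  refine LinearPMap.smul_le_smul _ ((toPMap_add_le _ _ _).trans ?_)
  refine LinearPMap.add_le_add ?_ ?_
  · exact toPMap_comp_le_opMul_toPMap_top fun x hx => (h k ⟨x, hx⟩).1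
  · rw [← LinearMap.comp_neg]
    exact toPMap_comp_le_toPMap_top_opMul _ _

theorem drift_toPMap_top {ι : Type*} (Ω : Matrix κ κ ℂ) {T₀ D₀ : 𝓗 →ₗ[ℂ] 𝓗} {T D : κ → 𝓗 →ₗ[ℂ] 𝓗}
    (X : ι → 𝓗 →ₗ.[ℂ] 𝓗) (i : ι)
    (h₀ : ∀ x : (X i).domain, ∃ hx : T₀ x ∈ (X i).domain,
      X i ⟨T₀ x, hx⟩ = T₀ (X i x) - D₀ x)
    (h : ∀ j, ∀ x : (X i).domain, ∃ hx : T j x ∈ (X i).domain,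
      X i ⟨T j x, hx⟩ = T j (X i x) - D j x) :
    drift Ω (T₀.toPMap ⊤) (fun j => (T j).toPMap ⊤) X i =
      (Complex.I • D₀ + (1 / 2 : ℂ) • ∑ j, ∑ k,
        Ω j k • (D j ∘ₗ T k - T j ∘ₗ D k)).toPMap (X i).domain := by
  rw [drift, opComm_toPMap_left h₀, toPMap_smul]
  exact toPMap_add_eq_of_le (toPMap_le_decoherence Ω h)

theorem linComb_single [CompleteSpace 𝓗] {ι : Type*} [Fintype ι] [DecidableEq ι]
    (X : ι → 𝓗 →ₗ.[ℂ] 𝓗)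
    (hX : ∀ k, IsSelfAdjoint (X k)) (k : ι) (h : IsSelfAdjoint (linComb X (Pi.single k 1))) :
    linComb X (Pi.single k 1) = X k := by
  refine eq_of_le_of_isSelfAdjoint h (hX k) ?_
  have hle : ∑ l, ((Pi.single k (1 : ℝ) : ι → ℝ) l : ℂ) • X l ≤ X k := by
    have : X k = ∑ l, (if l = k then X k else 0) := by simp
    rw [this]
    refine LinearPMap.sum_le_sum _ fun l _ => ?_
    split_ifs with hl
    · subst hl; simp
    · simpa [hl] using zero_smul_le (X l)
  have hc := (hX k).isClosed
  have := hc.isClosable.closure_mono hle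
  refine this.trans (le_of_eq (eq_of_eq_graph ?_))
  rw [← hc.isClosable.graph_closure_eq_closure_graph]
  exact hc.submodule_topologicalClosure_eq

end OperatorProducts

/-! ### Unitary groups and their generators -/

theorem continuous_apply_of_norm_le {α E F : Type*} [TopologicalSpace α]
    [NormedAddCommGroup E] [NormedSpace ℂ E] [NormedAddCommGroup F] [NormedSpace ℂ F]
    {A : α → E →L[ℂ] F} {y : α → E} (hA : ∀ x, Continuous fun a => A a x)
    (hb : ∀ a x, ‖A a x‖ ≤ ‖x‖) (hy : Continuous y) : Continuous fun a => A a (y a) := by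
  refine continuous_iff_continuousAt.2 fun a₀ => ?_
  have h1 : Filter.Tendsto (fun a => A a (y a - y a₀)) (nhds a₀) (nhds 0) := by
    refine squeeze_zero_norm (fun a => hb a _) ?_
    have : Continuous fun a => ‖y a - y a₀‖ := by fun_prop
    simpa using this.tendsto a₀
  have h2 := h1.add ((hA (y a₀)).tendsto a₀)
  simpa [ContinuousAt] using h2

namespace IsUnitaryExp

variable {𝓗 : Type*} [NormedAddCommGroup 𝓗] [InnerProductSpace ℂ 𝓗] [CompleteSpace 𝓗]

theorem exists_apply_eq {A : 𝓗 →ₗ.[ℂ] 𝓗} {U : ℝ → 𝓗 →L[ℂ] 𝓗} (hU : IsUnitaryExp A U)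
    {x y : 𝓗} (h : HasDerivAt (fun t => U t x) (Complex.I • y) 0) :
    ∃ hx : x ∈ A.domain, A ⟨x, hx⟩ = y := by
  have hx := (hU.mem_domain_iff x).2 h.differentiableAt
  refine ⟨hx, ?_⟩
  have := (hU.hasDerivAt ⟨x, hx⟩).unique h
  exact (smul_right_injective 𝓗 Complex.I_ne_zero) this

end IsUnitaryExp

/-! ### Twisted convolution of symbols -/

section TwistedConvolution

variable {ι : Type*} [Fintype ι]

theorem integrable_mul_comp_sub {E : ((ι → ℝ) × (ι → ℝ)) → ℂ} (hE : Continuous E) {C : ℝ}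
    (hC : ∀ p, ‖E p‖ ≤ C) {P Q : (ι → ℝ) → ℂ} (hP : Integrable P) (hQ : Integrable Q) :
    Integrable (fun p : (ι → ℝ) × (ι → ℝ) => E p * (P p.2 * Q (p.1 - p.2)))
      (volume.prod volume) :=
  (hP.convolution_integrand (ContinuousLinearMap.mul ℝ ℂ) hQ).bdd_mul hE.aestronglyMeasurable
    (Filter.Eventually.of_forall hC)

theorem continuous_phase (Θ : Matrix ι ι ℝ) :
    Continuous fun p : (ι → ℝ) × (ι → ℝ) =>
      Complex.exp (Complex.I * ((p.1 ⬝ᵥ Θ *ᵥ p.2 : ℝ) : ℂ)) := by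
  have : Continuous fun p : (ι → ℝ) × (ι → ℝ) => p.1 ⬝ᵥ Θ *ᵥ p.2 :=
    continuous_fst.dotProduct (continuous_const.matrix_mulVec continuous_snd)
  fun_prop

theorem norm_phase (x : ℝ) : ‖Complex.exp (Complex.I * (x : ℂ))‖ = 1 := by
  rw [mul_comm, Complex.norm_exp_ofReal_mul_I]

theorem integrable_phase_mul_comp_sub (Θ : Matrix ι ι ℝ) {P Q : (ι → ℝ) → ℂ} (hP : Integrable P)
    (hQ : Integrable Q) :
    Integrable (fun p : (ι → ℝ) × (ι → ℝ) =>
      Complex.exp (Complex.I * ((p.1 ⬝ᵥ Θ *ᵥ p.2 : ℝ) : ℂ)) * (P p.2 * Q (p.1 - p.2)))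
      (volume.prod volume) :=
  integrable_mul_comp_sub (continuous_phase Θ) (fun _ => (norm_phase _).le) hP hQ

/-- The convolution of two symbols twisted by the Weyl phase factor. -/
noncomputable def twistedConv (Θ : Matrix ι ι ℝ) (P Q : (ι → ℝ) → ℂ) (u : ι → ℝ) : ℂ :=
  ∫ v, Complex.exp (Complex.I * ((u ⬝ᵥ Θ *ᵥ v : ℝ) : ℂ)) * (P v * Q (u - v))

theorem integrable_twistedConv (Θ : Matrix ι ι ℝ) {P Q : (ι → ℝ) → ℂ} (hP : Integrable P)
    (hQ : Integrable Q) : Integrable (twistedConv Θ P Q) :=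
  (integrable_phase_mul_comp_sub Θ hP hQ).integral_prod_left

theorem dotProduct_mulVec_self_of_transpose_eq_neg {Θ : Matrix ι ι ℝ} (hΘ : Θᵀ = -Θ)
    (u : ι → ℝ) : u ⬝ᵥ Θ *ᵥ u = 0 := by
  have h : u ⬝ᵥ Θ *ᵥ u = -(u ⬝ᵥ Θ *ᵥ u) := by
    conv_lhs => rw [dotProduct_mulVec, dotProduct_comm, ← mulVec_transpose, hΘ, neg_mulVec,
      dotProduct_neg]
  linarith

theorem dotProduct_mulVec_swap_of_transpose_eq_neg {Θ : Matrix ι ι ℝ} (hΘ : Θᵀ = -Θ)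
    (u v : ι → ℝ) : u ⬝ᵥ Θ *ᵥ v = -(v ⬝ᵥ Θ *ᵥ u) := by
  rw [dotProduct_mulVec, dotProduct_comm, ← mulVec_transpose, hΘ, neg_mulVec, dotProduct_neg]

end TwistedConvolution

/-! ### Weyl operators and their quantizations -/

namespace IsWeylSystem

variable {𝓗 : Type*} [NormedAddCommGroup 𝓗] [InnerProductSpace ℂ 𝓗] [CompleteSpace 𝓗]
  {ι : Type*} [Fintype ι] {Θ : Matrix ι ι ℝ} {X : ι → 𝓗 →ₗ.[ℂ] 𝓗} {W : (ι → ℝ) → 𝓗 →L[ℂ] 𝓗}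

theorem isUnitaryExp_apply [DecidableEq ι] (hW : IsWeylSystem Θ X W) (k : ι) :
    IsUnitaryExp (X k) fun t => W (t • Pi.single k 1) := by
  have h := hW.exp (Pi.single k 1)
  rwa [linComb_single X hW.selfAdjoint k h.selfAdjoint] at h

theorem map_zero (hW : IsWeylSystem Θ X W) : W 0 = 1 := by
  simpa using (hW.exp 0).map_zero

theorem norm_apply (hW : IsWeylSystem Θ X W) (u : ι → ℝ) (ψ : 𝓗) : ‖W u ψ‖ = ‖ψ‖ := by
  have h := (hW.exp u).unitary 1
  rw [one_smul] at h
  exact ContinuousLinearMap.norm_map_of_mem_unitary h ψ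

theorem apply_apply (hW : IsWeylSystem Θ X W) (u v : ι → ℝ) (ψ : 𝓗) :
    W u (W v ψ) = Complex.exp (-(Complex.I * ((u ⬝ᵥ Θ *ᵥ v : ℝ) : ℂ))) • W (u + v) ψ := by
  rw [hW.ccr u v, _root_.smul_apply, smul_smul, ← Complex.exp_add, neg_add_cancel,
    Complex.exp_zero, one_smul]
  rfl

theorem apply_comm (hW : IsWeylSystem Θ X W) (u v : ι → ℝ) (ψ : 𝓗) :
    W u (W v ψ) =
      Complex.exp (-(2 * Complex.I * ((u ⬝ᵥ Θ *ᵥ v : ℝ) : ℂ))) • W v (W u ψ) := by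
  rw [hW.apply_apply u v, hW.ccr' u v, _root_.smul_apply, smul_smul,
    ← Complex.exp_add, mul_apply_eq_comp]
  congr 2
  ring

/-- Only continuity along lines is assumed. The CCR factor `W u`, up to continuous phases, into
isometries along the coordinate axes, and strong continuity survives products of contractions. -/
theorem continuous_apply (hW : IsWeylSystem Θ X W) (ψ : 𝓗) : Continuous fun u => W u ψ := by
  classical
  have key : ∀ (s : Finset ι) (ψ : 𝓗),
      Continuous fun u : ι → ℝ => W (∑ k ∈ s, u k • Pi.single k (1 : ℝ)) ψ := by
    intro s
    induction s using Finset.induction_on with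
    | empty => intro ψ; simpa using continuous_const
    | insert k s hk ih =>
      intro ψ
      simp_rw [Finset.sum_insert hk, hW.ccr, _root_.smul_apply]
      refine Continuous.smul (by fun_prop) ?_
      refine continuous_apply_of_norm_le (A := fun u : ι → ℝ => W (u k • Pi.single k (1 : ℝ)))
        (fun x => ?_) (fun a x => (hW.norm_apply _ _).le) (ih ψ)
      exact ((hW.isUnitaryExp_apply k).continuous x).comp (_root_.continuous_apply k)
  have h := key Finset.univ ψ
  have e : ∀ u : ι → ℝ, ∑ k, u k • Pi.single k (1 : ℝ) = u := by
    intro u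
    ext l
    simp [Finset.sum_apply, Pi.single_apply]
  simpa only [e] using h

theorem exists_apply_weyl (hW : IsWeylSystem Θ X W) (k : ι) (u : ι → ℝ) (ψ : (X k).domain) :
    ∃ hx : W u ψ ∈ (X k).domain,
      X k ⟨W u ψ, hx⟩ = W u (X k ψ) - (2 * ((Θ *ᵥ u) k : ℝ) : ℂ) • W u (ψ : 𝓗) := by
  classical
  refine (hW.isUnitaryExp_apply k).exists_apply_eq ?_
  have h1 : HasDerivAt (fun t : ℝ => W u (W (t • Pi.single k 1) (ψ : 𝓗)))
      (W u (Complex.I • X k ψ)) 0 :=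
    ((W u).restrictScalars ℝ).hasFDerivAt.comp_hasDerivAt 0
      ((hW.isUnitaryExp_apply k).hasDerivAt ψ)
  have h2 : HasDerivAt (fun t : ℝ =>
      Complex.exp (-(2 * Complex.I * (((t • Pi.single k 1 : ι → ℝ) ⬝ᵥ Θ *ᵥ u : ℝ) : ℂ))))
      (-(2 * Complex.I * ((Θ *ᵥ u) k : ℝ))) 0 := by
    have h3 : HasDerivAt (fun t : ℝ => (t : ℂ) * -(2 * Complex.I * ((Θ *ᵥ u) k : ℝ)))
        (-(2 * Complex.I * ((Θ *ᵥ u) k : ℝ))) 0 := by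
      simpa using (Complex.ofRealCLM.hasDerivAt (x := (0 : ℝ))).mul_const
        (-(2 * Complex.I * ((Θ *ᵥ u) k : ℝ) : ℂ))
    have h4 := h3.cexp
    simp only [Complex.ofReal_zero, zero_mul, Complex.exp_zero, one_mul] at h4
    refine h4.congr_of_eventuallyEq (Filter.Eventually.of_forall fun t => ?_)
    simp only [smul_dotProduct, single_one_dotProduct, smul_eq_mul, Complex.ofReal_mul]
    congr 1
    ring
  have h5 := h2.smul h1
  simp_rw [hW.apply_comm _ u]
  refine h5.congr_deriv ?_
  simp only [zero_smul, hW.map_zero, zero_dotProduct, Complex.ofReal_zero, mul_zero, neg_zero,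
    Complex.exp_zero, one_apply_eq_self, smul_sub, smul_smul, neg_smul,
    map_smul, ← sub_eq_add_neg]
  congr 2 <;> ring

theorem integrable_smul (hW : IsWeylSystem Θ X W) {P : (ι → ℝ) → ℂ} (hP : Integrable P) (ψ : 𝓗) :
    Integrable fun u => P u • W u ψ := by
  refine hP.smul_bdd ‖ψ‖ (hW.continuous_apply ψ).aestronglyMeasurable ?_
  exact Filter.Eventually.of_forall fun u => (hW.norm_apply u ψ).le

/-- The Weyl quantization of an integrable symbol, as a bounded operator. -/
noncomputable def quantCLM (hW : IsWeylSystem Θ X W) {P : (ι → ℝ) → ℂ} (hP : Integrable P) :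
    𝓗 →L[ℂ] 𝓗 :=
  LinearMap.mkContinuous
    { toFun := fun ψ => ∫ u, P u • W u ψ
      map_add' := fun ψ φ => by
        simp_rw [map_add, smul_add]
        exact integral_add (hW.integrable_smul hP ψ) (hW.integrable_smul hP φ)
      map_smul' := fun c ψ => by
        simp_rw [map_smul, smul_comm _ c, integral_smul, RingHom.id_apply] }
    (∫ u, ‖P u‖) fun ψ => by
      refine (norm_integral_le_integral_norm _).trans (le_of_eq ?_)
      simp_rw [norm_smul, hW.norm_apply, integral_mul_const]

theorem quantCLM_apply (hW : IsWeylSystem Θ X W) {P : (ι → ℝ) → ℂ} (hP : Integrable P) (ψ : 𝓗) :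
    hW.quantCLM hP ψ = ∫ u, P u • W u ψ := rfl

theorem weylQuant_eq_toPMap (hW : IsWeylSystem Θ X W) {P : (ι → ℝ) → ℂ} (hP : Integrable P) :
    weylQuant W P = (hW.quantCLM hP : 𝓗 →ₗ[ℂ] 𝓗).toPMap ⊤ :=
  (LinearPMap.eq_of_le_of_domain_eq
    (LinearPMap.toPMap_le_iff.2 fun ψ _ =>
      ⟨show ψ ∈ weylDomain W P from hW.integrable_smul hP ψ, rfl⟩)
    (top_le_iff.1 fun ψ _ => hW.integrable_smul hP ψ).symm).symm

/-- The unbounded `X k` is moved past the integral weakly: pairing with `z ∈ dom (X k)` reduces the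
claim to the pointwise relation for `W u`, and self-adjointness turns the weak identity into
membership in the domain. -/
theorem exists_apply_quantCLM (hW : IsWeylSystem Θ X W) (k : ι) {P : (ι → ℝ) → ℂ}
    (hP : Integrable P) (hP' : Integrable fun u => (2 * ((Θ *ᵥ u) k : ℝ) : ℂ) * P u)
    (ψ : (X k).domain) :
    ∃ hx : hW.quantCLM hP ψ ∈ (X k).domain,
      X k ⟨hW.quantCLM hP ψ, hx⟩ = hW.quantCLM hP (X k ψ) - hW.quantCLM hP' ψ := by
  have hi := (hW.integrable_smul hP (X k ψ)).sub (hW.integrable_smul hP' (ψ : 𝓗))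
  refine LinearPMap.exists_apply_eq_of_isSelfAdjoint (hW.selfAdjoint k) fun z => ?_
  rw [quantCLM_apply, quantCLM_apply, quantCLM_apply,
    ← integral_sub (hW.integrable_smul hP _) (hW.integrable_smul hP' _), ← inner_conj_symm,
    ← inner_conj_symm _ (X k z)]
  congr 1
  refine (integral_inner hi _).symm.trans
    (Eq.trans ?_ (integral_inner (hW.integrable_smul hP _) _))
  congr 1
  ext u
  rw [Pi.sub_apply]
  obtain ⟨hx, e⟩ := hW.exists_apply_weyl k u ψ
  have h1 := LinearPMap.inner_apply_of_isSelfAdjoint (hW.selfAdjoint k) z ⟨_, hx⟩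
  rw [e] at h1
  rw [inner_smul_right, h1, ← inner_smul_right, smul_sub, smul_smul, mul_comm (P u)]


/-- With `w = u - v`, antisymmetry gives `W_v W_{u-v} = exp (i uᵀ Θ v) W_u`; Fubini does the rest.
-/
theorem quantCLM_quantCLM (hW : IsWeylSystem Θ X W) (hΘ : Θᵀ = -Θ) {P Q : (ι → ℝ) → ℂ}
    (hP : Integrable P) (hQ : Integrable Q) (ψ : 𝓗) :
    hW.quantCLM hP (hW.quantCLM hQ ψ) = hW.quantCLM (integrable_twistedConv Θ hP hQ) ψ := by
  have hi : Integrable (fun p : (ι → ℝ) × (ι → ℝ) =>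
      (Complex.exp (Complex.I * ((p.1 ⬝ᵥ Θ *ᵥ p.2 : ℝ) : ℂ)) * (P p.2 * Q (p.1 - p.2))) •
        W p.1 ψ) (volume.prod volume) := by
    refine (integrable_phase_mul_comp_sub Θ hP hQ).smul_bdd ‖ψ‖
      ((hW.continuous_apply ψ).comp continuous_fst).aestronglyMeasurable ?_
    exact Filter.Eventually.of_forall fun p => (hW.norm_apply _ ψ).le
  calc hW.quantCLM hP (hW.quantCLM hQ ψ)
      = ∫ v, ∫ w, (P v * Q w) • W v (W w ψ) := by
        simp_rw [quantCLM_apply]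
        congr 1
        ext v
        rw [← ContinuousLinearMap.integral_comp_comm _ (hW.integrable_smul hQ ψ), ← integral_smul]
        simp_rw [map_smul, smul_smul]
    _ = ∫ v, ∫ u, (P v * Q (u - v)) • W v (W (u - v) ψ) := by
        congr 1
        ext v
        exact (integral_sub_right_eq_self (fun w => (P v * Q w) • W v (W w ψ)) v).symm
    _ = ∫ v, ∫ u, (Complex.exp (Complex.I * ((u ⬝ᵥ Θ *ᵥ v : ℝ) : ℂ)) * (P v * Q (u - v))) •
          W u ψ := by
        congr 1
        ext v
        congr 1
        ext u
        rw [hW.apply_apply, smul_smul, add_sub_cancel, mulVec_sub, dotProduct_sub,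
          dotProduct_mulVec_self_of_transpose_eq_neg hΘ, sub_zero,
          dotProduct_mulVec_swap_of_transpose_eq_neg hΘ v u, Complex.ofReal_neg, mul_neg, neg_neg,
          mul_comm]
    _ = ∫ u, ∫ v, (Complex.exp (Complex.I * ((u ⬝ᵥ Θ *ᵥ v : ℝ) : ℂ)) * (P v * Q (u - v))) •
          W u ψ := (integral_integral_swap hi).symm
    _ = hW.quantCLM (integrable_twistedConv Θ hP hQ) ψ := by
        simp_rw [quantCLM_apply, integral_smul_const]
        rfl

end IsWeylSystem

/-! ### Linearity of the quantization in its symbol -/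

namespace IsWeylSystem

variable {𝓗 : Type*} [NormedAddCommGroup 𝓗] [InnerProductSpace ℂ 𝓗] [CompleteSpace 𝓗]
  {ι : Type*} [Fintype ι] {Θ : Matrix ι ι ℝ} {X : ι → 𝓗 →ₗ.[ℂ] 𝓗} {W : (ι → ℝ) → 𝓗 →L[ℂ] 𝓗}

theorem quantCLM_congr (hW : IsWeylSystem Θ X W) {P Q : (ι → ℝ) → ℂ} (hP : Integrable P)
    (hQ : Integrable Q) (h : P =ᵐ[volume] Q) : hW.quantCLM hP = hW.quantCLM hQ := by
  ext ψ
  refine integral_congr_ae ?_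
  filter_upwards [h] with u hu
  rw [hu]

theorem quantCLM_add (hW : IsWeylSystem Θ X W) {P Q : (ι → ℝ) → ℂ} (hP : Integrable P)
    (hQ : Integrable Q) (h : Integrable fun u => P u + Q u) :
    hW.quantCLM h = hW.quantCLM hP + hW.quantCLM hQ := by
  ext ψ
  rw [_root_.add_apply, quantCLM_apply, quantCLM_apply, quantCLM_apply,
    ← integral_add (hW.integrable_smul hP ψ) (hW.integrable_smul hQ ψ)]
  simp_rw [add_smul]

theorem quantCLM_sub (hW : IsWeylSystem Θ X W) {P Q : (ι → ℝ) → ℂ} (hP : Integrable P)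
    (hQ : Integrable Q) (h : Integrable fun u => P u - Q u) :
    hW.quantCLM h = hW.quantCLM hP - hW.quantCLM hQ := by
  ext ψ
  rw [_root_.sub_apply, quantCLM_apply, quantCLM_apply, quantCLM_apply,
    ← integral_sub (hW.integrable_smul hP ψ) (hW.integrable_smul hQ ψ)]
  simp_rw [sub_smul]

theorem quantCLM_const_mul (hW : IsWeylSystem Θ X W) {P : (ι → ℝ) → ℂ} (hP : Integrable P) (c : ℂ)
    (h : Integrable fun u => c * P u) : hW.quantCLM h = c • hW.quantCLM hP := by
  ext ψ
  rw [_root_.smul_apply, quantCLM_apply, quantCLM_apply, ← integral_smul]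
  simp_rw [mul_smul]

theorem quantCLM_sum (hW : IsWeylSystem Θ X W) {α : Type*} (s : Finset α)
    {P : α → (ι → ℝ) → ℂ} (hP : ∀ a, Integrable (P a)) (h : Integrable fun u => ∑ a ∈ s, P a u) :
    hW.quantCLM h = ∑ a ∈ s, hW.quantCLM (hP a) := by
  ext ψ
  rw [_root_.sum_apply, quantCLM_apply]
  simp_rw [quantCLM_apply]
  rw [← integral_finsetSum _ fun a _ => hW.integrable_smul (hP a) ψ]
  simp_rw [Finset.sum_smul]

end IsWeylSystem

/-! ### Integrability, symmetry and computation of `F` and `G` -/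

section Symbols

variable {ι κ : Type*} [Fintype ι] {Θ : Matrix ι ι ℝ}

theorem integrable_ofReal_coord_mul {P : (ι → ℝ) → ℂ} (hP : Integrable P)
    (hP1 : Integrable fun u => ‖u‖ • P u) (l : ι) : Integrable fun u => (u l : ℂ) * P u := by
  refine hP1.mono (Continuous.aestronglyMeasurable (by fun_prop) |>.mul hP.aestronglyMeasurable) ?_
  refine Filter.Eventually.of_forall fun u => ?_
  rw [norm_mul, norm_smul, Complex.norm_real, norm_norm]
  gcongr
  exact norm_le_pi_norm u l

theorem integrable_two_mul_mulVec_mul (Θ : Matrix ι ι ℝ) {P : (ι → ℝ) → ℂ} (hP : Integrable P)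
    (hP1 : Integrable fun u => ‖u‖ • P u) (k : ι) :
    Integrable fun u => (2 * ((Θ *ᵥ u) k : ℝ) : ℂ) * P u := by
  have h : Integrable fun u => ∑ l, (2 * (Θ k l : ℂ)) * ((u l : ℂ) * P u) :=
    integrable_finsetSum _ fun l _ => (integrable_ofReal_coord_mul hP hP1 l).const_mul _
  refine h.congr (Filter.Eventually.of_forall fun u => ?_)
  simp only [mulVec, dotProduct, Complex.ofReal_sum, Complex.ofReal_mul, Finset.mul_sum,
    Finset.sum_mul]
  exact Finset.sum_congr rfl fun l _ => by ring

theorem symbolK_apply (Ω : Matrix κ κ ℂ) (u v : ι → ℝ) (j k : κ) :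
    symbolK Θ Ω u v j k =
      (Complex.exp (Complex.I * ((u ⬝ᵥ Θ *ᵥ v : ℝ) : ℂ)) * Ω j k).im := rfl

theorem symbolK_itoMatrix [DecidableEq κ] (J : Matrix κ κ ℝ) (u v : ι → ℝ) :
    symbolK Θ (itoMatrix J) u v =
      Real.sin (u ⬝ᵥ Θ *ᵥ v) • (1 : Matrix κ κ ℝ) + Real.cos (u ⬝ᵥ Θ *ᵥ v) • J := by
  ext j k
  rw [symbolK_apply, mul_comm Complex.I]
  by_cases h : j = k <;> simp [itoMatrix, h, Complex.exp_ofReal_mul_I_re,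
    Complex.exp_ofReal_mul_I_im]
  ring

theorem itoMatrix_apply_swap [DecidableEq κ] {J : Matrix κ κ ℝ} (hJ : Jᵀ = -J) (j k : κ) :
    itoMatrix J k j = star (itoMatrix J j k) := by
  have h : J k j = -J j k := congrFun (congrFun hJ j) k
  by_cases hjk : j = k
  · subst hjk
    have : J j j = 0 := by linarith
    simp [itoMatrix, this]
  · simp [itoMatrix, h, hjk, Ne.symm hjk]

theorem symbolK_neg_neg (Ω : Matrix κ κ ℂ) (u v : ι → ℝ) :
    symbolK Θ Ω (-u) (-v) = symbolK Θ Ω u v := by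
  simp [symbolK, mulVec_neg]

theorem continuous_ofReal_symbolK (Ω : Matrix κ κ ℂ) (j k : κ) :
    Continuous fun p : (ι → ℝ) × (ι → ℝ) => (symbolK Θ Ω p.1 p.2 j k : ℂ) :=
  Complex.continuous_ofReal.comp
    (Complex.continuous_im.comp ((continuous_phase Θ).mul continuous_const))

theorem norm_ofReal_symbolK_le (Ω : Matrix κ κ ℂ) (u v : ι → ℝ) (j k : κ) :
    ‖(symbolK Θ Ω u v j k : ℂ)‖ ≤ ‖Ω j k‖ := by
  rw [Complex.norm_real, symbolK_apply]
  refine (Complex.abs_im_le_norm _).trans ?_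
  rw [norm_mul, norm_phase, one_mul]

theorem symbolG_apply (H : (ι → ℝ) → κ → ℂ) (u : ι → ℝ) (k : ι) (j : κ) :
    symbolG Θ H u k j = Complex.I * ((2 * ((Θ *ᵥ u) k : ℝ) : ℂ) * H u j) := by
  simp only [symbolG, mul_apply, vecMulVec_apply, mulVec, dotProduct, Complex.ofReal_sum,
    Complex.ofReal_mul, Finset.mul_sum, Finset.sum_mul, Matrix.smul_apply, Matrix.map_apply,
    smul_eq_mul]
  exact Finset.sum_congr rfl fun l _ => by ring

theorem symbolG_neg {H : (ι → ℝ) → κ → ℂ} (hH : ∀ u j, H (-u) j = star (H u j))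
    (u : ι → ℝ) (k : ι) (j : κ) : symbolG Θ H (-u) k j = star (symbolG Θ H u k j) := by
  simp [symbolG_apply, hH, mulVec_neg]

theorem integrable_symbolG {H : (ι → ℝ) → κ → ℂ}
    (hH : ∀ j, Integrable fun u => H u j) (hH1 : ∀ j, Integrable fun u => ‖u‖ • H u j)
    (k : ι) (j : κ) : Integrable fun u => symbolG Θ H u k j := by
  simp_rw [symbolG_apply]
  exact (integrable_two_mul_mulVec_mul Θ (hH j) (hH1 j) k).const_mul _

theorem two_I_mul_symbolK {Ω : Matrix κ κ ℂ} (hΩ : ∀ j k, Ω k j = star (Ω j k))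
    (u v : ι → ℝ) (j k : κ) :
    2 * Complex.I * (symbolK Θ Ω u v j k : ℂ) =
      Ω j k * Complex.exp (Complex.I * ((u ⬝ᵥ Θ *ᵥ v : ℝ) : ℂ)) -
        Ω k j * star (Complex.exp (Complex.I * ((u ⬝ᵥ Θ *ᵥ v : ℝ) : ℂ))) := by
  rw [hΩ j k, ← star_mul', mul_comm (Ω j k), Complex.star_def, Complex.sub_conj, symbolK_apply]
  push_cast
  ring

variable [Fintype κ]

theorem driftIntegrand_apply (Ω : Matrix κ κ ℂ) (H : (ι → ℝ) → κ → ℂ) (u v : ι → ℝ) (l : ι) :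
    driftIntegrand Θ Ω H u v l =
      ∑ j, ∑ k, (symbolK Θ Ω u v j k : ℂ) * (((v l : ℂ) * H v j) * H (u - v) k) := by
  simp only [driftIntegrand, Pi.smul_apply, smul_eq_mul, dotProduct, mulVec, Matrix.map_apply,
    Finset.mul_sum, Finset.sum_mul]
  exact Finset.sum_congr rfl fun j _ => Finset.sum_congr rfl fun k _ => by ring

theorem integrable_driftIntegrand_prod (Ω : Matrix κ κ ℂ) {H : (ι → ℝ) → κ → ℂ}
    (hH : ∀ j, Integrable fun u => H u j) (hH1 : ∀ j, Integrable fun u => ‖u‖ • H u j) :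
    Integrable (fun p : (ι → ℝ) × (ι → ℝ) => driftIntegrand Θ Ω H p.1 p.2)
      (volume.prod volume) := by
  refine Integrable.of_eval fun l => ?_
  simp_rw [driftIntegrand_apply]
  have h : ∀ j k, Integrable (fun p : (ι → ℝ) × (ι → ℝ) => (symbolK Θ Ω p.1 p.2 j k : ℂ) *
      ((fun v : ι → ℝ => (v l : ℂ) * H v j) p.2 * (fun w => H w k) (p.1 - p.2)))
      (volume.prod volume) := fun j k =>
    integrable_mul_comp_sub (E := fun p => (symbolK Θ Ω p.1 p.2 j k : ℂ)) (C := ‖Ω j k‖)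
      (P := fun v : ι → ℝ => (v l : ℂ) * H v j) (Q := fun w => H w k)
      (continuous_ofReal_symbolK Ω j k) (fun p => norm_ofReal_symbolK_le Ω p.1 p.2 j k)
      (integrable_ofReal_coord_mul (hH j) (hH1 j) l) (hH k)
  exact integrable_finsetSum _ fun j _ => integrable_finsetSum _ fun k _ => h j k

theorem symbolF_apply (Ω : Matrix κ κ ℂ) (H₀ : (ι → ℝ) → ℂ) (H : (ι → ℝ) → κ → ℂ)
    (u : ι → ℝ) (k : ι) :
    symbolF Θ Ω H₀ H u k = Complex.I * ((2 * ((Θ *ᵥ u) k : ℝ) : ℂ) * H₀ u) +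
      ∑ l, 2 * Complex.I * (Θ k l : ℂ) * (∫ v, driftIntegrand Θ Ω H u v) l := by
  simp only [symbolF, mulVec_add, Pi.add_apply]
  congr 1
  · simp only [mulVec, dotProduct, Complex.ofReal_sum, Complex.ofReal_mul, Finset.mul_sum,
      Finset.sum_mul, Matrix.smul_apply, Matrix.map_apply, Pi.smul_apply, smul_eq_mul]
    exact Finset.sum_congr rfl fun l _ => by ring

theorem driftIntegrand_neg_neg (Ω : Matrix κ κ ℂ) {H : (ι → ℝ) → κ → ℂ}
    (hH : ∀ u j, H (-u) j = star (H u j)) (u v : ι → ℝ) :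
    driftIntegrand Θ Ω H (-u) (-v) = -star (driftIntegrand Θ Ω H u v) := by
  ext l
  have h : ∀ k, H (-u - -v) k = star (H (u - v) k) := fun k => by
    rw [← hH, neg_sub_neg, neg_sub]
  simp only [driftIntegrand_apply, symbolK_neg_neg, h, hH, Pi.neg_apply, Pi.star_apply, star_sum,
    star_mul', ← Finset.sum_neg_distrib]
  refine Finset.sum_congr rfl fun j _ => Finset.sum_congr rfl fun k _ => ?_
  simp

theorem integral_driftIntegrand_neg (Ω : Matrix κ κ ℂ) {H : (ι → ℝ) → κ → ℂ}
    (hH : ∀ u j, H (-u) j = star (H u j)) (u : ι → ℝ) :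
    ∫ v, driftIntegrand Θ Ω H (-u) v = -star (∫ v, driftIntegrand Θ Ω H u v) := by
  rw [← integral_neg_eq_self]
  simp_rw [driftIntegrand_neg_neg Ω hH]
  rw [integral_neg]
  congr 1
  -- An equivalence commutes with the integral even without integrability, both sides then being
  -- `0`; hence the symmetry of `F` holds at every `u`.
  exact (starL' ℝ : (ι → ℂ) ≃L[ℝ] (ι → ℂ)).integral_comp_comm _

theorem symbolF_neg (Ω : Matrix κ κ ℂ) {H₀ : (ι → ℝ) → ℂ} (hH₀ : ∀ u, H₀ (-u) = star (H₀ u))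
    {H : (ι → ℝ) → κ → ℂ} (hH : ∀ u j, H (-u) j = star (H u j)) (u : ι → ℝ) (k : ι) :
    symbolF Θ Ω H₀ H (-u) k = star (symbolF Θ Ω H₀ H u k) := by
  simp only [symbolF_apply, integral_driftIntegrand_neg Ω hH, hH₀, mulVec_neg, star_add, star_sum]
  simp

theorem integrable_symbolF (Ω : Matrix κ κ ℂ) {H₀ : (ι → ℝ) → ℂ} (hH₀ : Integrable H₀)
    (hH₀1 : Integrable fun u => ‖u‖ • H₀ u) {H : (ι → ℝ) → κ → ℂ}
    (hH : ∀ j, Integrable fun u => H u j) (hH1 : ∀ j, Integrable fun u => ‖u‖ • H u j) (k : ι) :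
    Integrable fun u => symbolF Θ Ω H₀ H u k := by
  simp_rw [symbolF_apply]
  refine ((integrable_two_mul_mulVec_mul Θ hH₀ hH₀1 k).const_mul _).add ?_
  refine integrable_finsetSum _ fun l _ => Integrable.const_mul ?_ _
  exact (integrable_driftIntegrand_prod (Θ := Θ) Ω hH hH1).integral_prod_left.eval l

/-- Under `v ↦ u - v` the exponent `uᵀ Θ v` changes sign, since `uᵀ Θ u = 0`. -/
theorem twistedConv_eq_integral_conj (hΘ : Θᵀ = -Θ) (P Q : (ι → ℝ) → ℂ) (u : ι → ℝ) :
    twistedConv Θ P Q u =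
      ∫ v, star (Complex.exp (Complex.I * ((u ⬝ᵥ Θ *ᵥ v : ℝ) : ℂ))) * (Q v * P (u - v)) := by
  rw [twistedConv, ← integral_sub_left_eq_self _ volume u]
  congr 1
  ext v
  rw [sub_sub_cancel, mulVec_sub, dotProduct_sub, dotProduct_mulVec_self_of_transpose_eq_neg hΘ,
    mul_comm (P _)]
  congr 1
  rw [Complex.star_def, ← Complex.exp_conj]
  simp

theorem integrable_phase_conj_mul_comp_sub {P Q : (ι → ℝ) → ℂ} {u : ι → ℝ}
    (h : Integrable fun v =>
      Complex.exp (Complex.I * ((u ⬝ᵥ Θ *ᵥ v : ℝ) : ℂ)) * (P v * Q (u - v))) :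
    Integrable fun v =>
      star (Complex.exp (Complex.I * ((u ⬝ᵥ Θ *ᵥ v : ℝ) : ℂ))) * (P v * Q (u - v)) := by
  have hc : Continuous fun v => Complex.exp (Complex.I * ((u ⬝ᵥ Θ *ᵥ v : ℝ) : ℂ)) :=
    (continuous_phase Θ).comp (Continuous.prodMk_right u)
  have hm : AEStronglyMeasurable (fun v =>
      star (Complex.exp (Complex.I * ((u ⬝ᵥ Θ *ᵥ v : ℝ) : ℂ))) ^ 2) volume :=
    (Continuous.pow (continuous_star.comp hc) 2).aestronglyMeasurable
  -- Multiplying by the unimodular factor `(star e) ^ 2` replaces the phase `e` by `star e`.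
  have h2 := h.bdd_mul (c := 1) hm (Filter.Eventually.of_forall fun v => by
    rw [norm_pow, norm_star, norm_phase, one_pow])
  refine h2.congr (Filter.Eventually.of_forall fun v => ?_)
  have e : star (Complex.exp (Complex.I * ((u ⬝ᵥ Θ *ᵥ v : ℝ) : ℂ))) *
      Complex.exp (Complex.I * ((u ⬝ᵥ Θ *ᵥ v : ℝ) : ℂ)) = 1 := by
    rw [Complex.star_def, ← Complex.normSq_eq_conj_mul_self, Complex.normSq_eq_norm_sq, norm_phase]
    simp
  change _ ^ 2 * _ = _
  rw [sq, mul_assoc, ← mul_assoc _ _ (P v * _), e, one_mul]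

theorem half_sum_mul_integral_sub {α : Type*} [MeasurableSpace α] {μ : Measure α}
    (Ω : Matrix κ κ ℂ) {a b : κ → κ → α → ℂ} (ha : ∀ j k, Integrable (a j k) μ)
    (hb : ∀ j k, Integrable (b j k) μ) :
    (1 / 2 : ℂ) * ∑ j, ∑ k, Ω j k * (∫ x, a j k x ∂μ - ∫ x, b j k x ∂μ) =
      ∫ x, (1 / 2 : ℂ) * ∑ j, ∑ k, Ω j k * (a j k x - b j k x) ∂μ := by
  have i1 : ∀ j k, Integrable (fun x => Ω j k * (a j k x - b j k x)) μ := fun j k =>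
    ((ha j k).sub (hb j k)).const_mul (Ω j k)
  rw [integral_const_mul,
    integral_finsetSum _ fun j _ => integrable_finsetSum _ fun k _ => i1 j k]
  congr 1
  refine Finset.sum_congr rfl fun j _ => ?_
  rw [integral_finsetSum _ fun k _ => i1 j k]
  refine Finset.sum_congr rfl fun k _ => ?_
  rw [← integral_sub (ha j k) (hb j k)]
  exact (integral_const_mul _ _).symm

theorem sum_mul_driftIntegrand {Ω : Matrix κ κ ℂ} (hΩ : ∀ j k, Ω k j = star (Ω j k))
    (H : (ι → ℝ) → κ → ℂ) (u v : ι → ℝ) (i : ι) :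
    ∑ l, 2 * Complex.I * (Θ i l : ℂ) * driftIntegrand Θ Ω H u v l =
      (1 / 2 : ℂ) * ∑ j, ∑ k, Ω j k *
        (Complex.exp (Complex.I * ((u ⬝ᵥ Θ *ᵥ v : ℝ) : ℂ)) *
            (((2 * ((Θ *ᵥ v) i : ℝ) : ℂ) * H v j) * H (u - v) k) -
          star (Complex.exp (Complex.I * ((u ⬝ᵥ Θ *ᵥ v : ℝ) : ℂ))) *
            (((2 * ((Θ *ᵥ v) i : ℝ) : ℂ) * H v k) * H (u - v) j)) := by
  have hc : (((Θ *ᵥ v) i : ℝ) : ℂ) = ∑ l, (Θ i l : ℂ) * (v l : ℂ) := by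
    simp [mulVec, dotProduct]
  set e := Complex.exp (Complex.I * ((u ⬝ᵥ Θ *ᵥ v : ℝ) : ℂ)) with he
  set c : ℂ := (((Θ *ᵥ v) i : ℝ) : ℂ)
  have hr : ∑ j, ∑ k, Ω j k * (e * (((2 * c) * H v j) * H (u - v) k) -
      star e * (((2 * c) * H v k) * H (u - v) j)) =
      ∑ j, ∑ k, (Ω j k * e - Ω k j * star e) * (2 * c * H v j * H (u - v) k) := by
    simp_rw [mul_sub, sub_mul, Finset.sum_sub_distrib]
    -- Exchanging `j` and `k` in the conjugate terms gives both kinds the common factor `H v j * H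
    -- (u - v) k`.
    rw [Finset.sum_comm (f := fun j k => Ω j k * (star e * _))]
    congr 1 <;> exact Finset.sum_congr rfl fun j _ => Finset.sum_congr rfl fun k _ => by ring
  have hl : ∀ l, 2 * Complex.I * (Θ i l : ℂ) * driftIntegrand Θ Ω H u v l =
      ((Θ i l : ℂ) * (v l : ℂ)) * ∑ j, ∑ k, (Ω j k * e - Ω k j * star e) *
        (H v j * H (u - v) k) := by
    intro l
    simp_rw [driftIntegrand_apply, he, ← two_I_mul_symbolK hΩ, Finset.mul_sum]
    exact Finset.sum_congr rfl fun j _ => Finset.sum_congr rfl fun k _ => by ring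
  rw [hr, Finset.sum_congr rfl fun l _ => hl l, ← Finset.sum_mul, ← hc]
  simp_rw [Finset.mul_sum]
  exact Finset.sum_congr rfl fun j _ => Finset.sum_congr rfl fun k _ => by ring

theorem symbolF_ae_eq (hΘ : Θᵀ = -Θ) {Ω : Matrix κ κ ℂ} (hΩ : ∀ j k, Ω k j = star (Ω j k))
    (H₀ : (ι → ℝ) → ℂ) {H : (ι → ℝ) → κ → ℂ}
    (hH : ∀ j, Integrable fun u => H u j) (hH1 : ∀ j, Integrable fun u => ‖u‖ • H u j) (i : ι) :
    (fun u => symbolF Θ Ω H₀ H u i) =ᵐ[volume] fun u =>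
      Complex.I * ((2 * ((Θ *ᵥ u) i : ℝ) : ℂ) * H₀ u) + (1 / 2 : ℂ) * ∑ j, ∑ k, Ω j k *
        (twistedConv Θ (fun u => (2 * ((Θ *ᵥ u) i : ℝ) : ℂ) * H u j) (fun u => H u k) u -
          twistedConv Θ (fun u => H u j) (fun u => (2 * ((Θ *ᵥ u) i : ℝ) : ℂ) * H u k) u) := by
  have h1 := (integrable_driftIntegrand_prod (Θ := Θ) Ω hH hH1).prod_right_ae
  have h2 : ∀ᵐ u, ∀ j k, Integrable fun v =>
      Complex.exp (Complex.I * ((u ⬝ᵥ Θ *ᵥ v : ℝ) : ℂ)) *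
        (((2 * ((Θ *ᵥ v) i : ℝ) : ℂ) * H v j) * H (u - v) k) :=
    ae_all_iff.2 fun j => ae_all_iff.2 fun k => (integrable_phase_mul_comp_sub Θ
      (integrable_two_mul_mulVec_mul Θ (hH j) (hH1 j) i) (hH k)).prod_right_ae
  filter_upwards [h1, h2] with u h1 h2
  rw [symbolF_apply]
  congr 1
  -- The vector integral is `0` as soon as one component fails to be integrable, so this needs `h1`
  -- and the identity is claimed only almost everywhere.
  have e2 : ∀ l, (∫ v, driftIntegrand Θ Ω H u v) l = ∫ v, driftIntegrand Θ Ω H u v l :=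
    fun l => eval_integral (fun l => h1.eval l) l
  simp_rw [e2, ← integral_const_mul]
  rw [← integral_finsetSum _ fun l _ => (h1.eval l).const_mul _]
  simp_rw [sum_mul_driftIntegrand hΩ, twistedConv_eq_integral_conj hΘ (fun u => H u _)]
  exact (half_sum_mul_integral_sub Ω h2
    fun j k => integrable_phase_conj_mul_comp_sub (P := fun v =>
      (2 * ((Θ *ᵥ v) i : ℝ) : ℂ) * H v k) (Q := fun v => H v j) (h2 k j)).symm

end Symbols

/-! ### Drift and dispersion as restricted quantizations -/

namespace IsWeylSystem

variable {𝓗 : Type*} [NormedAddCommGroup 𝓗] [InnerProductSpace ℂ 𝓗] [CompleteSpace 𝓗]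
  {ι κ : Type*} [Fintype ι] {Θ : Matrix ι ι ℝ} {X : ι → 𝓗 →ₗ.[ℂ] 𝓗}
  {W : (ι → ℝ) → 𝓗 →L[ℂ] 𝓗} {H : (ι → ℝ) → κ → ℂ}

theorem dispersion_eq_toPMap (hW : IsWeylSystem Θ X W)
    (hH : ∀ j, Integrable fun u => H u j) (hH1 : ∀ j, Integrable fun u => ‖u‖ • H u j)
    (i : ι) (j : κ) :
    dispersion (fun j => weylQuant W fun u => H u j) X i j =
      (hW.quantCLM (integrable_symbolG (Θ := Θ) hH hH1 i j) : 𝓗 →ₗ[ℂ] 𝓗).toPMap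
        (X i).domain := by
  have hD := fun j => integrable_two_mul_mulVec_mul Θ (hH j) (hH1 j) i
  simp_rw [fun j => hW.weylQuant_eq_toPMap (hH j)]
  rw [dispersion_toPMap_top (D := fun j => (hW.quantCLM (hD j) : 𝓗 →ₗ[ℂ] 𝓗)) X i j
    fun x => hW.exists_apply_quantCLM i (hH j) (hD j) x,
    hW.quantCLM_congr (integrable_symbolG hH hH1 i j) ((hD j).const_mul Complex.I)
      (Filter.Eventually.of_forall fun u => symbolG_apply H u i j),
    hW.quantCLM_const_mul (hD j)]
  rfl

variable [Fintype κ] {H₀ : (ι → ℝ) → ℂ}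

theorem drift_eq_toPMap (hW : IsWeylSystem Θ X W) (hΘ : Θᵀ = -Θ) {Ω : Matrix κ κ ℂ}
    (hΩ : ∀ j k, Ω k j = star (Ω j k)) (hH₀ : Integrable H₀)
    (hH₀1 : Integrable fun u => ‖u‖ • H₀ u)
    (hH : ∀ j, Integrable fun u => H u j) (hH1 : ∀ j, Integrable fun u => ‖u‖ • H u j) (i : ι) :
    drift Ω (weylQuant W H₀) (fun j => weylQuant W fun u => H u j) X i =
      (hW.quantCLM (integrable_symbolF (Θ := Θ) Ω hH₀ hH₀1 hH hH1 i) : 𝓗 →ₗ[ℂ] 𝓗).toPMap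
        (X i).domain := by
  have hD₀ := integrable_two_mul_mulVec_mul Θ hH₀ hH₀1 i
  have hD := fun j => integrable_two_mul_mulVec_mul Θ (hH j) (hH1 j) i
  simp_rw [hW.weylQuant_eq_toPMap hH₀, fun j => hW.weylQuant_eq_toPMap (hH j)]
  rw [drift_toPMap_top Ω (D₀ := (hW.quantCLM hD₀ : 𝓗 →ₗ[ℂ] 𝓗))
    (D := fun j => (hW.quantCLM (hD j) : 𝓗 →ₗ[ℂ] 𝓗)) X i
    (fun x => hW.exists_apply_quantCLM i hH₀ hD₀ x)
    fun j x => hW.exists_apply_quantCLM i (hH j) (hD j) x]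
  congr 1
  have c1 := fun j k => integrable_twistedConv Θ (hD j) (hH k)
  have c2 := fun j k => integrable_twistedConv Θ (hH j) (hD k)
  have s0 := fun j k => (c1 j k).sub (c2 j k)
  have s1 := fun j k => (s0 j k).const_mul (Ω j k)
  have s2 := fun j => integrable_finsetSum Finset.univ fun k _ => s1 j k
  have s3 := integrable_finsetSum Finset.univ fun j _ => s2 j
  rw [hW.quantCLM_congr (integrable_symbolF Ω hH₀ hH₀1 hH hH1 i)
      ((hD₀.const_mul Complex.I).add (s3.const_mul (1 / 2 : ℂ)))
      (symbolF_ae_eq hΘ hΩ H₀ hH hH1 i)]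
  rw [hW.quantCLM_add (hD₀.const_mul Complex.I) (s3.const_mul (1 / 2 : ℂ)),
    hW.quantCLM_const_mul hD₀, hW.quantCLM_const_mul s3, hW.quantCLM_sum _ s2]
  simp_rw [fun j => hW.quantCLM_sum Finset.univ (s1 j) (s2 j),
    fun j k => hW.quantCLM_const_mul (s0 j k) (Ω j k) (s1 j k),
    fun j k => hW.quantCLM_sub (c1 j k) (c2 j k) (s0 j k)]
  ext ψ
  simp [LinearMap.sum_apply, hW.quantCLM_quantCLM hΘ]

end IsWeylSystem

theorem mainTheorem4
    {𝓗 : Type*} [NormedAddCommGroup 𝓗] [InnerProductSpace ℂ 𝓗] [CompleteSpace 𝓗]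
    {ι κ : Type*} [Fintype ι] [Fintype κ] [DecidableEq κ]
    (Θ : Matrix ι ι ℝ) (hΘ : Θᵀ = -Θ)
    (J : Matrix κ κ ℝ) (hJ : Jᵀ = -J)
    (X : ι → 𝓗 →ₗ.[ℂ] 𝓗) (W : (ι → ℝ) → 𝓗 →L[ℂ] 𝓗) (hXW : IsWeylSystem Θ X W)
    (H₀ : (ι → ℝ) → ℂ) (H : (ι → ℝ) → κ → ℂ)
    (hH₀_herm : ∀ u, H₀ (-u) = star (H₀ u))
    (hH_herm : ∀ u j, H (-u) j = star (H u j))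
    (hH₀_int : Integrable H₀) (hH₀_int1 : Integrable fun u => ‖u‖ • H₀ u)
    (hH_int : ∀ j, Integrable fun u => H u j)
    (hH_int1 : ∀ j, Integrable fun u => ‖u‖ • H u j)
    (h₀ : 𝓗 →ₗ.[ℂ] 𝓗) (h : κ → 𝓗 →ₗ.[ℂ] 𝓗)
    (hh₀ : h₀ = weylQuant W H₀) (hh : ∀ j, h j = weylQuant W fun u => H u j) :
    -- the kernel `K`
    (∀ u v, symbolK Θ (itoMatrix J) u v =
      Real.sin (u ⬝ᵥ Θ *ᵥ v) • (1 : Matrix κ κ ℝ) + Real.cos (u ⬝ᵥ Θ *ᵥ v) • J) ∧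
    -- the integral in the definition of `F` converges absolutely for almost every `u`
    (∀ᵐ u : ι → ℝ, Integrable (driftIntegrand Θ (itoMatrix J) H u)) ∧
    -- `F` and `G` are Hermitian and absolutely integrable
    (∀ u k, symbolF Θ (itoMatrix J) H₀ H (-u) k = star (symbolF Θ (itoMatrix J) H₀ H u k)) ∧
    (∀ u k j, symbolG Θ H (-u) k j = star (symbolG Θ H u k j)) ∧
    (∀ k, Integrable fun u => symbolF Θ (itoMatrix J) H₀ H u k) ∧
    (∀ k j, Integrable fun u => symbolG Θ H u k j) ∧
    -- all the quantizations involved are everywhere defined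
    h₀.domain = ⊤ ∧ (∀ j, (h j).domain = ⊤) ∧
    (∀ k, (weylQuant W fun u => symbolF Θ (itoMatrix J) H₀ H u k).domain = ⊤) ∧
    (∀ k j, (weylQuant W fun u => symbolG Θ H u k j).domain = ⊤) ∧
    -- `f = ∫ F(u) W_u du`: equality on the dense domain of `X k`, which is exactly the natural
    -- domain of `f k`, and, after closing `f k`, equality of operators
    (∀ k, drift (itoMatrix J) h₀ h X k =
        (weylQuant W fun u => symbolF Θ (itoMatrix J) H₀ H u k).domRestrict (X k).domain ∧
      (drift (itoMatrix J) h₀ h X k).closure =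
        weylQuant W fun u => symbolF Θ (itoMatrix J) H₀ H u k) ∧
    -- `g = ∫ G(u) W_u du`, in the same sense
    (∀ k j, dispersion h X k j =
        (weylQuant W fun u => symbolG Θ H u k j).domRestrict (X k).domain ∧
      (dispersion h X k j).closure = weylQuant W fun u => symbolG Θ H u k j) := by
  have hΩ := itoMatrix_apply_swap hJ
  have hF := integrable_symbolF (Θ := Θ) (itoMatrix J) hH₀_int hH₀_int1 hH_int hH_int1
  have hG := integrable_symbolG (Θ := Θ) hH_int hH_int1
  obtain rfl : h = fun j => weylQuant W fun u => H u j := funext hh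
  subst hh₀
  refine ⟨symbolK_itoMatrix J,
    (integrable_driftIntegrand_prod (itoMatrix J) hH_int hH_int1).prod_right_ae,
    symbolF_neg _ hH₀_herm hH_herm, symbolG_neg hH_herm, hF, hG, ?_, fun j => ?_, fun k => ?_,
    fun k j => ?_, fun k => ?_, fun k j => ?_⟩
  · rw [hXW.weylQuant_eq_toPMap hH₀_int, LinearMap.toPMap_domain]
  · beta_reduce
    rw [hXW.weylQuant_eq_toPMap (hH_int j), LinearMap.toPMap_domain]
  · rw [hXW.weylQuant_eq_toPMap (hF k), LinearMap.toPMap_domain]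
  · rw [hXW.weylQuant_eq_toPMap (hG k j), LinearMap.toPMap_domain]
  · rw [hXW.weylQuant_eq_toPMap (hF k), LinearPMap.domRestrict_toPMap_top,
      hXW.drift_eq_toPMap hΘ hΩ hH₀_int hH₀_int1 hH_int hH_int1 k]
    exact ⟨rfl, LinearPMap.closure_toPMap_of_dense _ (hXW.selfAdjoint k).dense_domain⟩
  · rw [hXW.weylQuant_eq_toPMap (hG k j), LinearPMap.domRestrict_toPMap_top,
      hXW.dispersion_eq_toPMap hH_int hH_int1 k j]
    exact ⟨rfl, LinearPMap.closure_toPMap_of_dense _ (hXW.selfAdjoint k).dense_domain⟩
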